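/- Let $L>2$ be a prime, let $p\in[0,1]$, and let $\Delta$ be the graph Laplacian of the cycle $\mathbb Z/L\mathbb Z$, i.e. $(\Delta\psi)(j)=2\psi(j)-\psi(j-1)-\psi(j+1)$. Let $V=\mathrm{diag}(\omega_j)_{j\in\mathbb Z/L\mathbb Z}$, where the $\omega_j$ are independent random variables, each equal to $1$ with probability $p$ and to $-1$ with probability $1-p$, and put $H_t=\Delta+tV$ for $t\in\mathbb R$. Consider the two conditions on $H_t$: (a) all eigenvalues of $H_t$ are simple; (b) every entry of every eigenvector of $H_t$ is nonzero. Call $V$ \emph{good} if $H_t$ satisfies both (a) and (b) for all but finitely many $t\in\mathbb R$, and \emph{bad} if for every $t\in\mathbb R$ at least one of (a), (b) fails. Then \[ \mathbb P(V\text{ is bad}) = L\,\bigl(p^2+(1-p)^2\bigr)^{\frac{L-1}{2}} - (L-1)\bigl(p^L+(1-p)^L\bigr). \] In particular, if $p\neq 0,1$, then $\mathbb P(V\text{ is good})\to 1$ as $L\to\infty$ along the primes. -/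

import Mathlib

open MeasureTheory

noncomputable section

namespace Anderson

/-- The Hamiltonian `H_t = Δ + t V` on a finite graph `G`, where `Δ` is the graph Laplacian,
`(Δ ψ)(j) = ∑_{k ∼ j} (ψ(j) - ψ(k))`, and `V = diag(v)` is the onsite potential. -/
def hamiltonian {X : Type*} [Fintype X] [DecidableEq X] (G : SimpleGraph X)
    [DecidableRel G.Adj] (v : X → ℝ) (t : ℝ) : Matrix X X ℝ :=
  G.lapMatrix ℝ + t • Matrix.diagonal v

/-- Every eigenvalue of the (real symmetric) matrix `A` is simple. -/
def HasSimpleEigenvalues {X : Type*} [Fintype X] [DecidableEq X] (A : Matrix X X ℝ) : Prop :=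
  ∀ μ : ℝ, Module.End.HasEigenvalue (Matrix.toLin' A) μ →
    Module.finrank ℝ (Module.End.eigenspace (Matrix.toLin' A) μ) = 1

/-- All entries of all eigenvectors of `A` are nonzero. -/
def HasNonvanishingEigenvectors {X : Type*} [Fintype X] [DecidableEq X]
    (A : Matrix X X ℝ) : Prop :=
  ∀ (μ : ℝ) (φ : X → ℝ), Module.End.HasEigenvector (Matrix.toLin' A) μ φ → ∀ i, φ i ≠ 0

/-- The potential `v` is good: `H_t` has simple eigenvalues and non-vanishing eigenvectors for
all but finitely many real `t`. -/
def IsGood {X : Type*} [Fintype X] [DecidableEq X] (G : SimpleGraph X)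
    [DecidableRel G.Adj] (v : X → ℝ) : Prop :=
  {t : ℝ | ¬ (HasSimpleEigenvalues (hamiltonian G v t) ∧
    HasNonvanishingEigenvectors (hamiltonian G v t))}.Finite

/-- The potential `v` is bad: for every real `t`, `H_t` fails to have simple eigenvalues or
fails to have non-vanishing eigenvectors. -/
def IsBad {X : Type*} [Fintype X] [DecidableEq X] (G : SimpleGraph X)
    [DecidableRel G.Adj] (v : X → ℝ) : Prop :=
  ∀ t : ℝ, ¬ (HasSimpleEigenvalues (hamiltonian G v t) ∧
    HasNonvanishingEigenvectors (hamiltonian G v t))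

/-- The law of a random potential on the vertex set `X` whose values are i.i.d., equal to `1`
with probability `p` and to `-1` with probability `1 - p`: the product measure. -/
def potentialLaw (X : Type*) [Fintype X] (p : unitInterval) : Measure (X → ℝ) :=
  Measure.pi fun _ : X => ProbabilityTheory.bernoulliMeasure (1 : ℝ) (-1) p

end Anderson

end

/-! On a cycle of odd prime length a sign potential is bad exactly when it is invariant under the
reflection about some vertex, and good otherwise; the probability is then a count of symmetric sign
patterns.

If `V` is symmetric about `j`, functions odd about `j` form a nonzero subspace invariant under every
`H_t`. It contains an eigenvector, which vanishes at `j` (`isBad_of_isSymmetricAbout`).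

Conversely, (a) or (b) fails iff some eigenvector has a zero. For a fixed vertex `j` this is the
vanishing of a Krylov determinant, a polynomial in `t` (`det_krylov_eq_zero_iff`). So if `V` is not
good, there is one `j` such that every `H_t` has an eigenvector vanishing at `j`. As `t → 0` these
accumulate at an eigenvector of `Δ` vanishing at `j`, a sine wave `c (χ(x - j) - χ(j - x))`.
First-order perturbation theory in the plane spanned by `χ` and `χ⁻¹` gives `∑ (V(j + y) - V(j - y))
χ²(y) = 0`. The only integer relations among the `L`-th roots of unity, `L` prime, have equal
coefficients, and the one at `y = 0` vanishes, so `V` is symmetric about `j`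
(`symmetric_of_forall_exists_eigenvector`).

Symmetry about a given `j` leaves one fixed point and `(L - 1) / 2` pairs, hence has probability
`(p² + (1 - p)²) ^ ((L - 1) / 2)`. Two distinct centres force a constant potential, which is counted
`L` times instead of once; this is the subtracted term. -/

noncomputable section

namespace Anderson

open Matrix

/-! ### Krylov determinants and the polynomial dependence on `t`. -/

/-- A nonzero invariant subspace of a real symmetric matrix contains an eigenvector. -/
theorem exists_hasEigenvector_mem {X : Type*} [Fintype X] [DecidableEq X] {A : Matrix X X ℝ}
    (hA : A.IsHermitian) {W : Submodule ℝ (X → ℝ)} (hW : W ≠ ⊥)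
    (hinv : ∀ w ∈ W, A *ᵥ w ∈ W) :
    ∃ μ : ℝ, ∃ φ ∈ W, Module.End.HasEigenvector (Matrix.toLin' A) μ φ := by
  have hsymm := Matrix.isSymmetric_toEuclideanLin_iff.2 hA
  let e := WithLp.linearEquiv 2 ℝ (X → ℝ)
  let W' : Submodule ℝ (EuclideanSpace ℝ X) := W.comap e.toLinearMap
  have hinv' : ∀ w ∈ W', Matrix.toEuclideanLin A w ∈ W' := fun w hw => hinv _ hw
  have hres := hsymm.restrict_invariant hinv'
  obtain ⟨w, hwW, hw⟩ := Submodule.exists_mem_ne_zero_of_ne_bot hW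
  have : Nontrivial W' := by
    refine ⟨⟨⟨e.symm w, by simpa [W'] using hwW⟩, 0, fun h => hw ?_⟩⟩
    have h' := congrArg (fun z : W' => e z.1) h
    simpa using h'
  -- The supremum of the Rayleigh quotient of the restricted symmetric operator is an eigenvalue.
  obtain ⟨μ, hμ⟩ : ∃ μ, Module.End.HasEigenvalue ((Matrix.toEuclideanLin A).restrict hinv') μ :=
    ⟨_, hres.hasEigenvalue_iSup_of_finiteDimensional⟩
  obtain ⟨φ, hφ⟩ := hμ.exists_hasEigenvector
  refine ⟨μ, e φ.1, φ.2, ?_, ?_⟩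
  rotate_left
  · intro h
    apply hφ.2
    ext1
    exact e.injective (by simpa using h)
  · rw [Module.End.mem_eigenspace_iff]
    have h := congrArg (fun z : W' => e z.1) hφ.apply_eq_smul
    exact h

/-- The rows of the Krylov matrix are the `j`-th rows of the powers of `A`. -/
def krylov {R : Type*} [CommRing R] {n : ℕ} (A : Matrix (Fin n) (Fin n) R) (j : Fin n) :
    Matrix (Fin n) (Fin n) R :=
  Matrix.of fun m i => (A ^ (m : ℕ)) j i

theorem krylov_mulVec {R : Type*} [CommRing R] {n : ℕ} (A : Matrix (Fin n) (Fin n) R) (j : Fin n)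
    (w : Fin n → R) (m : Fin n) : (krylov A j *ᵥ w) m = ((A ^ (m : ℕ)) *ᵥ w) j := rfl

theorem krylov_map {R S : Type*} [CommRing R] [CommRing S] (f : R →+* S) {n : ℕ}
    (A : Matrix (Fin n) (Fin n) R) (j : Fin n) :
    krylov (A.map f) j = (krylov A j).map f := by
  ext m i
  simp [krylov, ← Matrix.map_pow]

/-- Cayley–Hamilton: every power of `A` is a combination of the powers below `n`. -/
theorem pow_mulVec_eq_zero_of_lt {R : Type*} [CommRing R] [Nontrivial R] {n : ℕ}
    {A : Matrix (Fin n) (Fin n) R}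
    {j : Fin n} {w : Fin n → R} (h : ∀ m < n, ((A ^ m) *ᵥ w) j = 0) (m : ℕ) :
    ((A ^ m) *ᵥ w) j = 0 := by
  have hn : n ≠ 0 := by rintro rfl; exact j.elim0
  have hdeg : (Polynomial.X ^ m %ₘ A.charpoly).natDegree < n := by
    have h1 := Polynomial.natDegree_modByMonic_lt (Polynomial.X ^ m) A.charpoly_monic
      (fun h1 => hn (by simpa [h1] using (A.charpoly_natDegree_eq_dim).symm))
    simpa [A.charpoly_natDegree_eq_dim] using h1
  rw [Matrix.pow_eq_aeval_mod_charpoly, Polynomial.aeval_eq_sum_range' hdeg, Matrix.sum_mulVec,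
    Finset.sum_apply]
  refine Finset.sum_eq_zero fun i hi => ?_
  simp [Matrix.smul_mulVec, h i (Finset.mem_range.1 hi)]

theorem pow_mulVec_of_hasEigenvector {X : Type*} [Fintype X] [DecidableEq X] {A : Matrix X X ℝ}
    {μ : ℝ} {φ : X → ℝ} (h : Module.End.HasEigenvector (Matrix.toLin' A) μ φ) (m : ℕ) :
    (A ^ m) *ᵥ φ = μ ^ m • φ := by
  have := h.pow_apply m
  rwa [← Matrix.toLin'_pow, Matrix.toLin'_apply] at this

/-- The Krylov determinant at `j` of a real symmetric matrix vanishes exactly when some eigenvector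
vanishes at `j`. -/
theorem det_krylov_eq_zero_iff {n : ℕ} {A : Matrix (Fin n) (Fin n) ℝ} (hA : A.IsHermitian)
    (j : Fin n) :
    (krylov A j).det = 0 ↔
      ∃ μ φ, Module.End.HasEigenvector (Matrix.toLin' A) μ φ ∧ φ j = 0 := by
  rw [← Matrix.exists_mulVec_eq_zero_iff]
  constructor
  · rintro ⟨w, hw, hK⟩
    -- The largest `A`-invariant subspace of vectors vanishing at `j`.
    let W : Submodule ℝ (Fin n → ℝ) :=
      { carrier := {w | ∀ m : ℕ, ((A ^ m) *ᵥ w) j = 0}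
        add_mem' := fun ha hb m => by simp [Matrix.mulVec_add, ha m, hb m]
        zero_mem' := fun m => by simp
        smul_mem' := fun c a ha m => by simp [Matrix.mulVec_smul, ha m] }
    have hwW : w ∈ W :=
      pow_mulVec_eq_zero_of_lt fun m hm => (congrFun hK ⟨m, hm⟩ :)
    obtain ⟨μ, φ, hφW, hφ⟩ := exists_hasEigenvector_mem hA (W := W)
      (fun h => hw (by simpa [h] using hwW))
      (fun w hw m => by
        have := hw (m + 1)
        rwa [pow_succ, ← Matrix.mulVec_mulVec] at this)
    exact ⟨μ, φ, hφ, by simpa using hφW 0⟩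
  · rintro ⟨μ, φ, hφ, hj⟩
    refine ⟨φ, hφ.2, funext fun m => ?_⟩
    rw [krylov_mulVec, pow_mulVec_of_hasEigenvector hφ]
    simp [hj]

theorem hamiltonian_isHermitian {X : Type*} [Fintype X] [DecidableEq X] (G : SimpleGraph X)
    [DecidableRel G.Adj] (v : X → ℝ) (t : ℝ) : (hamiltonian G v t).IsHermitian := by
  unfold hamiltonian
  refine Matrix.IsHermitian.add ?_ ?_
  · exact (G.isSymm_lapMatrix (R := ℝ))
  · rw [Matrix.IsHermitian, Matrix.conjTranspose_smul]
    simp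

/-- A real matrix violates simplicity or non-vanishing exactly when some eigenvector has a zero. -/
theorem not_simple_and_nonvanishing_iff {X : Type*} [Fintype X] [DecidableEq X]
    (A : Matrix X X ℝ) :
    ¬ (HasSimpleEigenvalues A ∧ HasNonvanishingEigenvectors A) ↔
      ∃ j μ φ, Module.End.HasEigenvector (Matrix.toLin' A) μ φ ∧ φ j = 0 := by
  constructor
  · contrapose!
    intro h
    refine ⟨fun μ hμ => ?_, fun μ φ hφ i => h i μ φ hφ⟩
    obtain ⟨φ, hφ⟩ := hμ.exists_hasEigenvector
    obtain ⟨j, hj⟩ := Function.ne_iff.1 hφ.2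
    rw [finrank_eq_one_iff_of_nonzero' (⟨φ, hφ.1⟩ : Module.End.eigenspace (Matrix.toLin' A) μ)
      (fun h0 => hφ.2 (congrArg Subtype.val h0))]
    rintro ⟨ψ, hψ⟩
    refine ⟨ψ j / φ j, Subtype.ext ?_⟩
    by_contra hne
    -- This combination cancels the entry at `j`, so it would be an eigenvector with a zero.
    refine h j μ (ψ - (ψ j / φ j) • φ) ⟨Submodule.sub_mem _ hψ (Submodule.smul_mem _ _ hφ.1), ?_⟩ ?_
    · intro h0
      exact hne (sub_eq_zero.1 h0).symm
    · simp only [Pi.sub_apply, Pi.smul_apply, smul_eq_mul]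
      have : φ j ≠ 0 := hj
      field_simp
      ring
  · rintro ⟨j, μ, φ, hφ, hj⟩ ⟨-, h⟩
    exact h μ φ hφ j hj

/-- The Hamiltonian with the coupling constant replaced by a polynomial variable. -/
def hamiltonianPoly {X : Type*} [Fintype X] [DecidableEq X] (G : SimpleGraph X)
    [DecidableRel G.Adj] (v : X → ℝ) : Matrix X X (Polynomial ℝ) :=
  (G.lapMatrix ℝ).map Polynomial.C +
    (Polynomial.X : Polynomial ℝ) • (Matrix.diagonal v).map Polynomial.C

theorem hamiltonianPoly_map_eval {X : Type*} [Fintype X] [DecidableEq X] (G : SimpleGraph X)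
    [DecidableRel G.Adj] (v : X → ℝ) (t : ℝ) :
    (hamiltonianPoly G v).map (Polynomial.evalRingHom t) = hamiltonian G v t := by
  ext a b
  by_cases h : a = b
  · simp [hamiltonianPoly, hamiltonian, h]
    ring
  · simp [hamiltonianPoly, hamiltonian, h]

/-- A single `t` without an eigenvector vanishing at `j` makes the Krylov determinant at `j` a
nonzero polynomial, with finitely many roots; the exceptional set is the union of these root sets
over the finitely many `j`. -/
theorem isGood_of_forall_exists {n : ℕ} {G : SimpleGraph (Fin n)} [DecidableRel G.Adj]
    {v : Fin n → ℝ}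
    (h : ∀ j, ∃ t, ¬ ∃ μ φ,
      Module.End.HasEigenvector (Matrix.toLin' (hamiltonian G v t)) μ φ ∧ φ j = 0) :
    IsGood G v := by
  let D : Fin n → Polynomial ℝ := fun j => (krylov (hamiltonianPoly G v) j).det
  have hD : ∀ j t, (D j).IsRoot t ↔ ∃ μ φ,
      Module.End.HasEigenvector (Matrix.toLin' (hamiltonian G v t)) μ φ ∧ φ j = 0 := by
    intro j t
    rw [← det_krylov_eq_zero_iff (hamiltonian_isHermitian G v t), ← hamiltonianPoly_map_eval,
      krylov_map, Polynomial.IsRoot, ← Polynomial.coe_evalRingHom, RingHom.map_det]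
    rfl
  refine (Set.finite_iUnion fun j => Polynomial.finite_setOfPred_isRoot (p := D j) ?_).subset ?_
  · intro h0
    obtain ⟨t, ht⟩ := h j
    exact ht ((hD j t).1 (by simp [h0]))
  · intro t ht
    obtain ⟨j, hj⟩ := (not_simple_and_nonvanishing_iff _).1 ht
    exact Set.mem_iUnion.2 ⟨j, (hD j t).2 hj⟩

theorem IsGood.not_isBad {X : Type*} [Fintype X] [DecidableEq X] {G : SimpleGraph X}
    [DecidableRel G.Adj] {v : X → ℝ} (h : IsGood G v) : ¬ IsBad G v := fun hb =>
  Set.infinite_univ (h.subset fun t _ => hb t)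

/-! ### Characters and the spectrum of the cycle Laplacian. -/

/-- The operator `Δ + t v` on functions on the cycle `ZMod L`. -/
def cycleOp {R : Type*} [CommRing R] {L : ℕ} (v : ZMod L → R) (t : R) (φ : ZMod L → R)
    (x : ZMod L) : R :=
  2 * φ x - φ (x - 1) - φ (x + 1) + t * (v x * φ x)

/-- Symmetry of `Δ`, by summation by parts. -/
theorem sum_mul_cycleOp_zero {R : Type*} [CommRing R] {L : ℕ} [NeZero L] (v ψ φ : ZMod L → R) :
    ∑ x, ψ x * cycleOp v 0 φ x = ∑ x, cycleOp v 0 ψ x * φ x := by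
  have h1 : ∑ x, ψ x * φ (x - 1) = ∑ x, ψ (x + 1) * φ x :=
    Fintype.sum_equiv (Equiv.subRight 1) _ _ fun x => by simp
  have h2 : ∑ x, ψ x * φ (x + 1) = ∑ x, ψ (x - 1) * φ x :=
    Fintype.sum_equiv (Equiv.addRight 1) _ _ fun x => by simp
  simp only [cycleOp, zero_mul, add_zero, mul_sub, sub_mul, Finset.sum_sub_distrib, h1, h2,
    mul_left_comm _ (2 : R), mul_assoc]
  ring

theorem cycleOp_zero_addChar {L : ℕ} (v : ZMod L → ℂ) (χ : AddChar (ZMod L) ℂ) (j x : ZMod L) :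
    cycleOp v 0 (fun y => χ (y - j)) x = (2 - χ 1 - χ (-1)) * χ (x - j) := by
  have h1 : x - 1 - j = (x - j) + -1 := by ring
  have h2 : x + 1 - j = (x - j) + 1 := by ring
  simp only [cycleOp, h1, h2, AddChar.map_add_eq_mul]
  ring

/-- Injectivity of the discrete Fourier transform. -/
theorem exists_addChar_sum_ne_zero {L : ℕ} [NeZero L] {f : ZMod L → ℂ} (hf : f ≠ 0) :
    ∃ χ : AddChar (ZMod L) ℂ, ∑ x, χ x * f x ≠ 0 := by
  have h : ZMod.dft f ≠ 0 := by simpa using hf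
  obtain ⟨k, hk⟩ := Function.ne_iff.1 h
  refine ⟨AddChar.mulShift ZMod.stdAddChar (-k), ?_⟩
  rw [ZMod.dft_apply, Pi.zero_apply] at hk
  convert hk using 3 with x
  rw [AddChar.mulShift_apply, smul_eq_mul, mul_comm x k, neg_mul]

theorem addChar_zmod_apply {L : ℕ} [NeZero L] (χ : AddChar (ZMod L) ℂ) (x : ZMod L) :
    χ x = χ 1 ^ x.val := by
  rw [← AddChar.map_nsmul_eq_pow]
  simp

theorem isPrimitiveRoot_addChar_one {L : ℕ} (hL : L.Prime) [NeZero L] {χ : AddChar (ZMod L) ℂ}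
    (hχ : χ ≠ 1) : IsPrimitiveRoot (χ 1) L := by
  have : Fact L.Prime := ⟨hL⟩
  have h1 : χ 1 ^ L = 1 := by
    rw [← AddChar.map_nsmul_eq_pow]; simp
  exact IsPrimitiveRoot.iff_orderOf.2
    (orderOf_eq_prime h1 ((AddChar.zmod_char_ne_one_iff L χ).1 hχ))

theorem mul_self_ne_one {L : ℕ} (hL : L.Prime) (h2 : 2 < L) [NeZero L] {χ : AddChar (ZMod L) ℂ}
    (hχ : χ ≠ 1) : χ * χ ≠ 1 := by
  intro h
  have h' : χ 1 ^ 2 = 1 := by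
    have := DFunLike.congr_fun h 1
    rwa [AddChar.mul_apply, AddChar.one_apply, ← pow_two] at this
  exact absurd (Nat.le_of_dvd two_pos ((isPrimitiveRoot_addChar_one hL hχ).dvd_of_pow_eq_one 2 h'))
    (by omega)

/-- Integer relations between the values of a nontrivial character of prime order. -/
theorem eq_of_sum_mul_addChar_eq_zero {L : ℕ} (hL : L.Prime) [NeZero L] {χ : AddChar (ZMod L) ℂ}
    (hχ : χ ≠ 1) {a : ZMod L → ℤ} (ha : ∑ x, (a x : ℂ) * χ x = 0) (x y : ZMod L) : a x = a y := by
  obtain ⟨n, rfl⟩ : ∃ n, L = n + 1 := ⟨L - 1, by have := hL.pos; omega⟩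
  -- For `L` prime, the minimal polynomial of a primitive `L`-th root of unity is `1 + X + ⋯ + X ^
  -- (L - 1)`.
  refine ((isPrimitiveRoot_addChar_one hL hχ).sum_eq_zero_iff_forall_eq_int hL a).1 ?_ x y
  rw [← ha]
  refine Finset.sum_congr rfl fun x _ => ?_
  rw [addChar_zmod_apply χ x]
  rfl

/-- An eigenfunction of the Laplacian on the cycle that vanishes at `j` is a sine wave
centred at `j`. -/
theorem exists_addChar_of_cycleOp_zero {L : ℕ} (hL : L.Prime) (h2 : 2 < L) [NeZero L]
    {v f : ZMod L → ℂ} (hf : f ≠ 0) {j : ZMod L} (hj : f j = 0) {E : ℂ}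
    (hE : ∀ x, cycleOp v 0 f x = E * f x) :
    ∃ χ : AddChar (ZMod L) ℂ, χ ≠ 1 ∧ E = 2 - χ 1 - χ (-1) ∧
      ∃ c : ℂ, c ≠ 0 ∧ ∀ x, f x = c * (χ (x - j) - χ (j - x)) := by
  obtain ⟨χ, hχ⟩ := exists_addChar_sum_ne_zero hf
  -- Eigenvectors of the symmetric `Δ` that pair nontrivially share their eigenvalue.
  have hEχ : E = 2 - χ 1 - χ (-1) := by
    have h := sum_mul_cycleOp_zero v (fun y => χ (y - 0)) f
    simp only [hE, cycleOp_zero_addChar] at h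
    simp only [sub_zero] at h
    simp only [mul_left_comm _ E, mul_assoc, ← Finset.mul_sum] at h
    exact mul_right_cancel₀ hχ h
  have hzw : χ 1 * χ (-1) = 1 := by
    rw [← AddChar.map_add_eq_mul]; simp
  have hrec : ∀ x, f (x + 1 + 1) = (χ 1 + χ (-1)) * f (x + 1) - f x := by
    intro x
    have h := hE (x + 1)
    rw [hEχ, cycleOp, add_sub_cancel_right] at h
    linear_combination -h
  have hcast : ∀ x, ∃ n : ℕ, x = j + (n : ZMod L) := fun x => ⟨(x - j).val, by simp⟩
  -- Two consecutive zeros would propagate through the second-order recursion.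
  have hfj : f (j + 1) ≠ 0 := by
    intro h0
    have : ∀ n : ℕ, f (j + n) = 0 ∧ f (j + n + 1) = 0 := by
      intro n
      induction n with
      | zero => simp [hj, h0]
      | succ n ih =>
        have := hrec (j + n)
        rw [ih.1, ih.2] at this
        push_cast
        rw [← add_assoc]
        exact ⟨ih.2, by simpa using this⟩
    apply hf
    funext x
    obtain ⟨n, rfl⟩ := hcast x
    exact (this n).1
  -- For trivial `χ` the solution is linear, `n * f (j + 1)`, which contradicts periodicity at `n =
  -- L`.
  have hχ1 : χ ≠ 1 := by
    rintro rfl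
    have : ∀ n : ℕ, f (j + n) = n * f (j + 1) ∧ f (j + n + 1) = (n + 1) * f (j + 1) := by
      intro n
      induction n with
      | zero => simp [hj]
      | succ n ih =>
        have := hrec (j + n)
        rw [ih.1, ih.2] at this
        push_cast
        rw [← add_assoc]
        refine ⟨ih.2, ?_⟩
        rw [this]
        simp only [AddChar.one_apply]
        ring
    have hL' := (this L).1
    rw [ZMod.natCast_self, add_zero, hj] at hL'
    exact mul_ne_zero (by simpa using hL.ne_zero) hfj hL'.symm
  have hne : χ 1 - χ (-1) ≠ 0 := by
    intro h0
    have : χ 1 ^ 2 = 1 := by linear_combination hzw + χ 1 * h0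
    exact absurd (Nat.le_of_dvd two_pos
      ((isPrimitiveRoot_addChar_one hL hχ1).dvd_of_pow_eq_one 2 this)) (by omega)
  refine ⟨χ, hχ1, hEχ, f (j + 1) / (χ 1 - χ (-1)), div_ne_zero hfj hne, ?_⟩
  have key : ∀ n : ℕ, f (j + n) * (χ 1 - χ (-1)) = f (j + 1) * (χ 1 ^ n - χ (-1) ^ n) ∧
      f (j + n + 1) * (χ 1 - χ (-1)) = f (j + 1) * (χ 1 ^ (n + 1) - χ (-1) ^ (n + 1)) := by
    intro n
    induction n with
    | zero => simp [hj]
    | succ n ih =>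
      push_cast
      rw [← add_assoc]
      refine ⟨ih.2, ?_⟩
      rw [hrec]
      linear_combination (χ 1 + χ (-1)) * ih.2 - ih.1 +
        f (j + 1) * (χ 1 ^ n - χ (-1) ^ n) * hzw
  intro x
  obtain ⟨n, rfl⟩ := hcast x
  have h1 : χ (j + n - j) = χ 1 ^ n := by
    rw [← AddChar.map_nsmul_eq_pow]; simp
  have h2 : χ (j - (j + n)) = χ (-1) ^ n := by
    rw [← AddChar.map_nsmul_eq_pow]; simp
  rw [h1, h2, div_mul_eq_mul_div, eq_div_iff hne, (key n).1]

/-! ### First-order perturbation as `t → 0`. -/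

/-- Testing an eigenvector of `Δ + t v` against two eigenvectors of `Δ` with a common eigenvalue
yields a determinant identity from which all eigenvalues have been eliminated. -/
theorem det_test_eq {R : Type*} [CommRing R] [IsDomain R] {L : ℕ} [NeZero L]
    {v φ ψ₁ ψ₂ : ZMod L → R} {t E E₀ : R}
    (ht : t ≠ 0) (hφ : ∀ x, cycleOp v t φ x = E * φ x)
    (h₁ : ∀ x, cycleOp v 0 ψ₁ x = E₀ * ψ₁ x) (h₂ : ∀ x, cycleOp v 0 ψ₂ x = E₀ * ψ₂ x) :
    (∑ x, ψ₁ x * φ x) * (∑ x, ψ₂ x * (v x * φ x)) =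
      (∑ x, ψ₂ x * φ x) * (∑ x, ψ₁ x * (v x * φ x)) := by
  have test : ∀ ψ : ZMod L → R, (∀ x, cycleOp v 0 ψ x = E₀ * ψ x) →
      t * ∑ x, ψ x * (v x * φ x) = (E - E₀) * ∑ x, ψ x * φ x := by
    intro ψ hψ
    have h := sum_mul_cycleOp_zero v ψ φ
    have h0 : ∀ x, cycleOp v 0 φ x = E * φ x - t * (v x * φ x) := by
      intro x
      rw [← hφ x]
      simp only [cycleOp]
      ring
    simp only [h0, hψ, mul_sub, Finset.sum_sub_distrib, mul_left_comm _ E, mul_left_comm _ t,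
      mul_assoc, ← Finset.mul_sum] at h
    linear_combination -h
  apply mul_left_cancel₀ ht
  -- Cross-multiplying the two tests cancels the unknown factor `E - E₀`.
  linear_combination (∑ x, ψ₁ x * φ x) * test ψ₂ h₂ - (∑ x, ψ₂ x * φ x) * test ψ₁ h₁

theorem cycleOp_smul {R : Type*} [CommRing R] {L : ℕ} (v : ZMod L → R) (t a : R)
    (φ : ZMod L → R) (x : ZMod L) : cycleOp v t (a • φ) x = a * cycleOp v t φ x := by
  simp only [cycleOp, Pi.smul_apply, smul_eq_mul]
  ring

theorem ofReal_cycleOp {L : ℕ} (v : ZMod L → ℝ) (t : ℝ) (φ : ZMod L → ℝ) (x : ZMod L) :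
    ((cycleOp v t φ x : ℝ) : ℂ) = cycleOp (fun y => (v y : ℂ)) t (fun y => (φ y : ℂ)) x := by
  simp [cycleOp]

/-- Eigenvectors of `Δ + t v` vanishing at `j` accumulate, as `t → 0`, at an eigenvector of `Δ`
vanishing at `j`, on which the first-order determinant identity holds. -/
theorem exists_limit_eigenvector {L : ℕ} [NeZero L] {v : ZMod L → ℝ} {j : ZMod L}
    (h : ∀ t : ℝ, ∃ E : ℝ, ∃ φ : ZMod L → ℝ, φ ≠ 0 ∧ φ j = 0 ∧ ∀ x, cycleOp v t φ x = E * φ x) :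
    ∃ E : ℝ, ∃ φ : ZMod L → ℝ, φ ≠ 0 ∧ φ j = 0 ∧ (∀ x, cycleOp v 0 φ x = E * φ x) ∧
      ∀ (ψ₁ ψ₂ : ZMod L → ℂ) (E₀ : ℂ), (∀ x, cycleOp (fun y => (v y : ℂ)) 0 ψ₁ x = E₀ * ψ₁ x) →
        (∀ x, cycleOp (fun y => (v y : ℂ)) 0 ψ₂ x = E₀ * ψ₂ x) →
        (∑ x, ψ₁ x * φ x) * (∑ x, ψ₂ x * (v x * φ x)) =
          (∑ x, ψ₂ x * φ x) * (∑ x, ψ₁ x * (v x * φ x)) := by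
  have h' : ∀ n : ℕ, ∃ φ ∈ Metric.sphere (0 : ZMod L → ℝ) 1, ∃ E : ℝ, φ j = 0 ∧
      ∀ x, cycleOp v (1 / ((n : ℝ) + 1)) φ x = E * φ x := by
    intro n
    obtain ⟨E, φ, hφ, hj, hE⟩ := h (1 / ((n : ℝ) + 1))
    have hn : ‖φ‖ ≠ 0 := norm_ne_zero_iff.2 hφ
    refine ⟨‖φ‖⁻¹ • φ, ?_, E, by simp [hj], fun x => ?_⟩
    · simp [norm_smul, hn]
    · rw [cycleOp_smul, hE, Pi.smul_apply, smul_eq_mul]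
      ring
  choose φ hφs E hj hE using h'
  obtain ⟨φ₀, hφ₀, σ, hσ, hlim⟩ := (isCompact_sphere (0 : ZMod L → ℝ) 1).tendsto_subseq hφs
  have hlimx : ∀ x, Filter.Tendsto (fun n => φ (σ n) x) Filter.atTop (nhds (φ₀ x)) :=
    fun x => (tendsto_pi_nhds.1 hlim) x
  have hlimC : ∀ x, Filter.Tendsto (fun n => (φ (σ n) x : ℂ)) Filter.atTop (nhds (φ₀ x : ℂ)) :=
    fun x => (Complex.continuous_ofReal.tendsto _).comp (hlimx x)
  have ht : Filter.Tendsto (fun n => 1 / ((σ n : ℝ) + 1)) Filter.atTop (nhds 0) :=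
    tendsto_one_div_add_atTop_nhds_zero_nat.comp hσ.tendsto_atTop
  have hop : ∀ x, Filter.Tendsto (fun n => cycleOp v (1 / ((σ n : ℝ) + 1)) (φ (σ n)) x)
      Filter.atTop (nhds (cycleOp v 0 φ₀ x)) := fun x =>
    ((((hlimx x).const_mul 2).sub (hlimx _)).sub (hlimx _)).add
      (ht.mul ((hlimx x).const_mul (v x)))
  have hφ₀ne : φ₀ ≠ 0 := by
    rintro rfl
    simp at hφ₀
  have hpos : ∑ x, φ₀ x * φ₀ x ≠ 0 := by
    intro h0
    apply hφ₀ne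
    funext x
    have := (Finset.sum_eq_zero_iff_of_nonneg fun x _ => mul_self_nonneg (φ₀ x)).1 h0 x
      (Finset.mem_univ x)
    simpa using this
  -- The Rayleigh quotient of the limit serves as eigenvalue, so convergence of the `E (σ n)` need
  -- not be proved separately.
  refine ⟨(∑ x, φ₀ x * cycleOp v 0 φ₀ x) / ∑ x, φ₀ x * φ₀ x, φ₀, hφ₀ne, ?_, ?_, ?_⟩
  · refine tendsto_nhds_unique (hlimx j) ?_
    simp [hj]
  · intro x
    rw [div_mul_eq_mul_div, eq_div_iff hpos]
    refine tendsto_nhds_unique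
      ((hop x).mul (tendsto_finsetSum _ fun y _ => (hlimx y).mul (hlimx y)))
      (((tendsto_finsetSum _ fun y _ => (hlimx y).mul (hop y)).mul (hlimx x)).congr fun n => ?_)
    simp only [hE, mul_left_comm _ (E (σ n)), ← Finset.mul_sum]
    ring
  · intro ψ₁ ψ₂ E₀ h₁ h₂
    have hs : ∀ ψ : ZMod L → ℂ, Filter.Tendsto (fun n => ∑ x, ψ x * (φ (σ n) x : ℂ)) Filter.atTop
        (nhds (∑ x, ψ x * (φ₀ x : ℂ))) := fun ψ =>
      tendsto_finsetSum _ fun x _ => (hlimC x).const_mul _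
    have hsv : ∀ ψ : ZMod L → ℂ, Filter.Tendsto
        (fun n => ∑ x, ψ x * ((v x : ℂ) * (φ (σ n) x : ℂ))) Filter.atTop
        (nhds (∑ x, ψ x * ((v x : ℂ) * (φ₀ x : ℂ)))) := fun ψ =>
      tendsto_finsetSum _ fun x _ => ((hlimC x).const_mul _).const_mul _
    refine tendsto_nhds_unique ((hs ψ₁).mul (hsv ψ₂))
      (((hs ψ₂).mul (hsv ψ₁)).congr fun n => ?_)
    refine (det_test_eq (v := fun y => (v y : ℂ)) (φ := fun y => (φ (σ n) y : ℂ))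
      (t := ((1 / ((σ n : ℝ) + 1) : ℝ) : ℂ)) (E := (E (σ n) : ℂ)) ?_ ?_ h₁ h₂).symm
    · exact_mod_cast (Nat.one_div_pos_of_nat (n := σ n)).ne'
    · intro x
      rw [← ofReal_cycleOp, hE, Complex.ofReal_mul]

/-- If for every coupling constant some eigenvector vanishes at `j`, then an integer potential on a
cycle of odd prime length is symmetric about `j`. -/
theorem symmetric_of_forall_exists_eigenvector {L : ℕ} (hL : L.Prime) (h2 : 2 < L) [NeZero L]
    {u : ZMod L → ℤ} {j : ZMod L}
    (h : ∀ t : ℝ, ∃ E : ℝ, ∃ φ : ZMod L → ℝ, φ ≠ 0 ∧ φ j = 0 ∧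
      ∀ x, cycleOp (fun y => (u y : ℝ)) t φ x = E * φ x) (x : ZMod L) :
    u (j + x) = u (j - x) := by
  obtain ⟨E, φ, hφ, hj, hE, hdet⟩ := exists_limit_eigenvector h
  obtain ⟨χ, hχ, hEχ, c, hc, hform⟩ := exists_addChar_of_cycleOp_zero hL h2
    (v := fun y => ((u y : ℝ) : ℂ)) (f := fun y => (φ y : ℂ)) (j := j) (E := (E : ℂ))
    (fun h0 => hφ (funext fun x => by simpa using congrFun h0 x)) (by simpa using hj)
    (fun x => by
      have := ofReal_cycleOp (fun y => (u y : ℝ)) 0 φ x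
      rw [hE, Complex.ofReal_zero] at this
      rw [← this]
      push_cast
      ring)
  -- `χ` and `χ⁻¹` share an eigenvalue, which is symmetric in `χ 1` and `χ (-1)`.
  have hdet' := hdet (fun y => χ (y - j)) (fun y => χ⁻¹ (y - j)) _
    (cycleOp_zero_addChar _ χ j)
    (fun x => by
      rw [cycleOp_zero_addChar _ χ⁻¹ j x]
      simp only [AddChar.inv_apply, neg_neg]
      rw [sub_right_comm])
  have shift : ∀ g : ZMod L → ℂ, ∑ x, g x = ∑ y, g (j + y) := fun g =>
    (Fintype.sum_equiv (Equiv.addLeft j) _ _ fun y => by simp).symm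
  have hinv : ∀ y, χ y * χ (-y) = 1 := fun y => by
    rw [← AddChar.map_add_eq_mul]; simp
  have hsq : ∑ y, χ y * χ y = 0 := by
    simpa using AddChar.sum_eq_zero_of_ne_one (mul_self_ne_one hL h2 hχ)
  have hsq' : ∑ y, χ (-y) * χ (-y) = 0 := by
    rw [← hsq]
    exact Fintype.sum_equiv (Equiv.neg _) _ _ fun y => by simp
  have hL0 : (L : ℂ) ≠ 0 := by simpa using hL.ne_zero
  have e1 : ∑ x, χ (x - j) * (φ x : ℂ) = -(c * L) := by
    rw [shift]
    simp only [hform, add_sub_cancel_left, sub_add_cancel_left, mul_left_comm _ c, mul_sub, hinv,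
      Finset.sum_sub_distrib, ← Finset.mul_sum, hsq]
    simp
  have e2 : ∑ x, χ⁻¹ (x - j) * (φ x : ℂ) = c * L := by
    rw [shift]
    simp only [hform, add_sub_cancel_left, sub_add_cancel_left, mul_left_comm _ c, mul_sub,
      AddChar.inv_apply, mul_comm (χ (- _)) (χ _), hinv,
      Finset.sum_sub_distrib, ← Finset.mul_sum, hsq']
    simp
  rw [e1, e2] at hdet'
  have hsum : ∑ y, ((u (j + y) : ℤ) : ℂ) * ((χ * χ) y - (χ * χ) (-y)) = 0 := by
    have hsum' : c * ∑ y, ((u (j + y) : ℤ) : ℂ) * ((χ * χ) y - (χ * χ) (-y)) =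
        ∑ x, χ (x - j) * (((u x : ℝ) : ℂ) * (φ x : ℂ)) +
          ∑ x, χ⁻¹ (x - j) * (((u x : ℝ) : ℂ) * (φ x : ℂ)) := by
      rw [shift fun x => χ (x - j) * (((u x : ℝ) : ℂ) * (φ x : ℂ)),
        shift fun x => χ⁻¹ (x - j) * (((u x : ℝ) : ℂ) * (φ x : ℂ)),
        ← Finset.sum_add_distrib, Finset.mul_sum]
      refine Finset.sum_congr rfl fun y _ => ?_
      simp only [hform, add_sub_cancel_left, sub_add_cancel_left, AddChar.inv_apply,
        AddChar.mul_apply]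
      push_cast
      ring
    -- The pairings of `φ` with `χ` and `χ⁻¹` are `-(c * L)` and `c * L`, so the determinant
    -- identity says that the two potential sums add up to zero.
    refine (mul_eq_zero.1 (hsum'.trans ?_)).resolve_left hc
    apply mul_left_cancel₀ (mul_ne_zero hc hL0)
    linear_combination -hdet'
  have hrel : ∑ y, ((u (j + y) - u (j - y) : ℤ) : ℂ) * (χ * χ) y = 0 := by
    have hneg : ∑ y, ((u (j + y) : ℤ) : ℂ) * (χ * χ) (-y) =
        ∑ y, ((u (j - y) : ℤ) : ℂ) * (χ * χ) y :=
      Fintype.sum_equiv (Equiv.neg _) _ _ fun y => by simp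
    simp only [mul_sub, Finset.sum_sub_distrib, hneg] at hsum
    simpa only [Int.cast_sub, sub_mul, Finset.sum_sub_distrib] using hsum
  -- The comparison is with the coefficient at `0`, which is `u j - u j = 0`.
  have := eq_of_sum_mul_addChar_eq_zero hL (mul_self_ne_one hL h2 hχ) hrel x 0
  simpa [sub_eq_zero] using this

/-! ### Reflection symmetry versus bad and good potentials. -/

/-- The function `u` on the cycle is invariant under the reflection fixing `j`. -/
def IsSymmetricAbout {α : Type*} {L : ℕ} (u : ZMod L → α) (j : ZMod L) : Prop :=
  ∀ x, u (j + x) = u (j - x)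

theorem hamiltonian_cycleGraph_mulVec {n : ℕ} (v : Fin (n + 3) → ℝ) (t : ℝ)
    (φ : Fin (n + 3) → ℝ) (x : Fin (n + 3)) :
    (hamiltonian (SimpleGraph.cycleGraph (n + 3)) v t *ᵥ φ) x =
      cycleOp (L := n + 3) v t φ x := by
  rw [hamiltonian, Matrix.add_mulVec, Pi.add_apply, SimpleGraph.lapMatrix_mulVec_apply,
    SimpleGraph.cycleGraph_degree_three_le, Matrix.smul_mulVec, Pi.smul_apply,
    Matrix.mulVec_diagonal, SimpleGraph.cycleGraph_neighborFinset, Finset.sum_pair]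
  · show _ = 2 * φ x - φ (x - 1) - φ (x + 1) + t * (v x * φ x)
    simp
    ring
  · simp only [ne_eq, sub_eq_iff_eq_add, add_assoc x, left_eq_add]
    exact ne_of_beq_false rfl

/-- A reflection-symmetric potential is bad: odd functions form an invariant subspace. -/
theorem isBad_of_isSymmetricAbout {n : ℕ} {v : Fin (n + 3) → ℝ} {j : ZMod (n + 3)}
    (hv : IsSymmetricAbout (L := n + 3) v j) : IsBad (SimpleGraph.cycleGraph (n + 3)) v := by
  intro t
  rw [not_simple_and_nonvanishing_iff]
  let W : Submodule ℝ (ZMod (n + 3) → ℝ) :=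
    { carrier := {φ | ∀ x : ZMod (n + 3), φ (j + x) = - φ (j - x)}
      add_mem' := fun {a b} ha hb x => by
        simp only [Pi.add_apply]
        rw [ha x, hb x, neg_add]
      zero_mem' := fun x => by simp
      smul_mem' := fun c a ha x => by
        simp only [Pi.smul_apply, smul_eq_mul]
        rw [ha x, mul_neg] }
  have hone : (1 : ZMod (n + 3)) ≠ -1 := by
    have : Fact (2 < n + 3) := ⟨by omega⟩
    exact (ZMod.neg_one_ne_one).symm
  have hne : W ≠ ⊥ := by
    -- The witness is the odd function `δ_{j+1} - δ_{j-1}`, nonzero because the length exceeds 2.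
    refine Submodule.ne_bot_iff _ |>.2
      ⟨fun x => (if x = j + 1 then 1 else 0) - (if x = j - 1 then 1 else 0), ?_, ?_⟩
    · intro x
      have h1 : j - x = j + 1 ↔ x = -1 := by
        constructor <;> intro h
        · linear_combination -h
        · linear_combination -h
      have h2 : j - x = j - 1 ↔ x = 1 := by
        constructor <;> intro h
        · linear_combination -h
        · linear_combination -h
      have h3 : j + x = j - 1 ↔ x = -1 := by
        rw [sub_eq_add_neg, add_right_inj]
      simp only [h1, h2, h3, add_right_inj]
      ring
    · intro h
      have h' := congrFun h (j + 1)
      rw [if_pos rfl, if_neg (by rwa [sub_eq_add_neg, add_right_inj])] at h'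
      simp at h'
  have hinv : ∀ w ∈ W, hamiltonian (SimpleGraph.cycleGraph (n + 3)) v t *ᵥ w ∈ W := by
    intro w hw x
    refine (hamiltonian_cycleGraph_mulVec v t w (j + x)).trans
      (Eq.trans ?_ (congrArg Neg.neg (hamiltonian_cycleGraph_mulVec v t w (j - x)).symm))
    have h1 := hw (x - 1)
    have h2 := hw (x + 1)
    have e1 : j + (x - 1) = j + x - 1 := by ring
    have e2 : j + (x + 1) = j + x + 1 := by ring
    have e3 : j - (x - 1) = j - x + 1 := by ring
    have e4 : j - (x + 1) = j - x - 1 := by ring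
    rw [e1, e3] at h1
    rw [e2, e4] at h2
    simp only [cycleOp, h1, h2, hw x, hv x]
    ring
  obtain ⟨μ, φ, hφW, hφ⟩ := exists_hasEigenvector_mem
    (hamiltonian_isHermitian (SimpleGraph.cycleGraph (n + 3)) v t) (W := W) hne hinv
  refine ⟨j, μ, φ, hφ, ?_⟩
  have h := hφW 0
  rw [add_zero, sub_zero] at h
  exact self_eq_neg.1 h

/-- An integer potential without reflection symmetry on a cycle of odd prime length is good. -/
theorem isGood_of_forall_not_isSymmetricAbout {n : ℕ} (hL : (n + 3).Prime) {u : ZMod (n + 3) → ℤ}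
    (hu : ∀ j, ¬ IsSymmetricAbout u j) :
    IsGood (SimpleGraph.cycleGraph (n + 3)) (fun x : Fin (n + 3) => (u x : ℝ)) := by
  refine isGood_of_forall_exists fun j => ?_
  by_contra! h
  refine hu j (symmetric_of_forall_exists_eigenvector hL (by omega) fun t => ?_)
  obtain ⟨μ, φ, hφ, hj⟩ := h t
  refine ⟨μ, φ, hφ.2, hj, fun x => ?_⟩
  exact (hamiltonian_cycleGraph_mulVec _ t φ x).symm.trans (congrFun hφ.apply_eq_smul x)

/-! ### Weighted count of symmetric functions. -/

/-- The sum of product weights over all functions constant on the fibres of `π`. -/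
theorem sum_prod_constant_on_fibers {X Y B R : Type*} [Fintype X] [DecidableEq X] [Fintype Y]
    [DecidableEq Y] [Fintype B] [CommSemiring R] (w : B → R) (π : X → Y)
    (hπ : Function.Surjective π) (P : (X → B) → Prop) [DecidablePred P]
    (hP : ∀ f, P f ↔ ∀ x x', π x = π x' → f x = f x') :
    ∑ f : X → B with P f, ∏ x, w (f x) =
      ∏ y, ∑ b, w b ^ Finset.card {x | π x = y} := by
  rw [Finset.prod_univ_sum, Fintype.piFinset_univ]
  refine (Finset.sum_nbij' (fun g => g ∘ π) (fun f y => f (Function.surjInv hπ y))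
    ?_ ?_ ?_ ?_ ?_).symm
  · intro g _
    simp only [Finset.mem_filter, Finset.mem_univ, true_and, hP]
    intro x x' h
    simp [h]
  · simp
  · intro g _
    funext y
    simp [Function.surjInv_eq hπ]
  · intro f hf
    simp only [Finset.mem_filter, Finset.mem_univ, true_and, hP] at hf
    funext x
    exact hf _ _ (Function.surjInv_eq hπ _)
  · intro g _
    simp only [Function.comp_apply]
    rw [Finset.prod_comp (fun y => w (g y)) π, Finset.image_univ_of_surjective hπ]

/-- The distance to `j` in the cycle of length `2 * m + 1`. -/
def cycleDist {m : ℕ} (j x : ZMod (2 * m + 1)) : Fin (m + 1) :=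
  ⟨(x - j).valMinAbs.natAbs, by
    have := ZMod.natAbs_valMinAbs_le (x - j)
    omega⟩

theorem cycleDist_eq_iff {m : ℕ} {j x y : ZMod (2 * m + 1)} :
    cycleDist j x = cycleDist j y ↔ x - j = y - j ∨ x - j = -(y - j) := by
  rw [cycleDist, cycleDist, Fin.mk.injEq, ZMod.natAbs_valMinAbs_eq_natAbs_valMinAbs]

theorem cycleDist_add_natCast {m : ℕ} (j : ZMod (2 * m + 1)) (k : Fin (m + 1)) :
    cycleDist j (j + (k : ℕ)) = k := by
  apply Fin.ext
  have : ((k : ℕ) : ZMod (2 * m + 1)).valMinAbs = (k : ℕ) :=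
    ZMod.valMinAbs_natCast_of_le_half (by omega)
  simp [cycleDist, this]

theorem filter_cycleDist_eq {m : ℕ} (j : ZMod (2 * m + 1)) (k : Fin (m + 1)) :
    Finset.filter (fun x => cycleDist j x = k) Finset.univ =
      {j + ((k : ℕ) : ZMod (2 * m + 1)), j - ((k : ℕ) : ZMod (2 * m + 1))} := by
  ext x
  rw [Finset.mem_filter_univ, ← cycleDist_add_natCast j k, cycleDist_eq_iff,
    cycleDist_add_natCast, Finset.mem_insert, Finset.mem_singleton, add_sub_cancel_left,
    sub_eq_iff_eq_add', sub_eq_iff_eq_add', ← sub_eq_add_neg]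

theorem card_filter_cycleDist_zero {m : ℕ} (j : ZMod (2 * m + 1)) :
    (Finset.filter (fun x => cycleDist j x = 0) Finset.univ).card = 1 := by
  simp [filter_cycleDist_eq]

theorem card_filter_cycleDist_succ {m : ℕ} (j : ZMod (2 * m + 1)) (k : Fin m) :
    (Finset.filter (fun x => cycleDist j x = k.succ) Finset.univ).card = 2 := by
  rw [filter_cycleDist_eq, Finset.card_pair]
  intro h
  have h2 : ((2 * (k + 1) : ℕ) : ZMod (2 * m + 1)) = 0 := by
    rw [Fin.val_succ] at h
    push_cast at h ⊢
    linear_combination h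
  rw [ZMod.natCast_eq_zero_iff] at h2
  have := Nat.le_of_dvd (by omega) h2
  omega

/-- The fibres of the distance to `j` are the orbits of the reflection, which brings symmetry under
`sum_prod_constant_on_fibers`. -/
theorem isSymmetricAbout_iff_cycleDist {α : Type*} {m : ℕ} (j : ZMod (2 * m + 1))
    (f : ZMod (2 * m + 1) → α) :
    IsSymmetricAbout f j ↔ ∀ x x', cycleDist j x = cycleDist j x' → f x = f x' := by
  constructor
  · intro hf x x' h
    rcases cycleDist_eq_iff.1 h with h | h
    · rw [sub_left_inj.1 h]
    · have := hf (x - j)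
      rwa [add_sub_cancel, h, sub_neg_eq_add, add_sub_cancel] at this
  · intro h x
    apply h
    rw [cycleDist_eq_iff]
    right
    ring

open Classical in
theorem sum_prod_isSymmetricAbout {B R : Type*} [Fintype B] [CommSemiring R] (w : B → R) {m : ℕ}
    (j : ZMod (2 * m + 1)) :
    ∑ f : ZMod (2 * m + 1) → B with IsSymmetricAbout f j, ∏ x, w (f x) =
      (∑ b, w b) * (∑ b, w b ^ 2) ^ m := by
  rw [sum_prod_constant_on_fibers w (cycleDist j) (fun k => ⟨_, cycleDist_add_natCast j k⟩) _
    (isSymmetricAbout_iff_cycleDist j), Fin.prod_univ_succ, card_filter_cycleDist_zero]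
  simp only [card_filter_cycleDist_succ]
  simp

theorem sum_prod_constant {X B R : Type*} [Fintype X] [DecidableEq X] [Nonempty X] [Fintype B]
    [CommSemiring R] (w : B → R) [DecidablePred fun f : X → B => ∀ x y, f x = f y] :
    ∑ f : X → B with ∀ x y, f x = f y, ∏ x, w (f x) = ∑ b, w b ^ Fintype.card X := by
  rw [sum_prod_constant_on_fibers w (fun _ : X => ()) (fun _ => ⟨Classical.arbitrary X, rfl⟩) _
    (fun f => by simp)]
  simp

/-- On a cycle of odd prime length, only constant functions have two reflection symmetries. -/
theorem eq_of_isSymmetricAbout_of_ne {α : Type*} {L : ℕ} (hL : L.Prime) (h2 : 2 < L)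
    {f : ZMod L → α} {i j : ZMod L} (hi : IsSymmetricAbout f i) (hj : IsSymmetricAbout f j)
    (hij : i ≠ j) (x y : ZMod L) : f x = f y := by
  have : Fact L.Prime := ⟨hL⟩
  have htwo : (2 : ZMod L) ≠ 0 := by
    intro h
    have h' : ((2 : ℕ) : ZMod L) = 0 := by exact_mod_cast h
    rw [ZMod.natCast_eq_zero_iff] at h'
    have := Nat.le_of_dvd two_pos h'
    omega
  have hd : 2 * (j - i) ≠ 0 := mul_ne_zero htwo (sub_ne_zero.2 hij.symm)
  -- The composite of the two reflections is the translation by `2 * (j - i)`; being nonzero, it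
  -- generates the group of prime order.
  have hstep : ∀ z, f (z + 2 * (j - i)) = f z := by
    intro z
    have h1 := hi (z - i)
    have h2 := hj (z + j - 2 * i)
    have e1 : i + (z - i) = z := by ring
    have e2 : i - (z - i) = 2 * i - z := by ring
    have e3 : j + (z + j - 2 * i) = z + 2 * (j - i) := by ring
    have e4 : j - (z + j - 2 * i) = 2 * i - z := by ring
    rw [e1, e2] at h1
    rw [e3, e4] at h2
    rw [h1, h2]
  have hmul : ∀ (k : ℕ) (z : ZMod L), f (z + k * (2 * (j - i))) = f z := by
    intro k z
    induction k with
    | zero => simp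
    | succ k ih =>
      rw [← ih, ← hstep (z + k * (2 * (j - i)))]
      congr 1
      push_cast
      ring
  have h := hmul ((y - x) / (2 * (j - i))).val x
  rw [ZMod.natCast_zmod_val, div_mul_cancel₀ _ hd, add_sub_cancel] at h
  exact h.symm

-- A nonconstant function has at most one centre of symmetry, while a constant one has `L` and is
-- overcounted `L - 1` times.
open Classical in
theorem indicator_exists_isSymmetricAbout {α : Type*} {L : ℕ} (hL : L.Prime) (h2 : 2 < L)
    [NeZero L] (f : ZMod L → α) :
    (if ∃ j, IsSymmetricAbout f j then (1 : ℝ) else 0) =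
      ∑ j, (if IsSymmetricAbout f j then (1 : ℝ) else 0) -
        ((L : ℝ) - 1) * (if ∀ x y, f x = f y then (1 : ℝ) else 0) := by
  by_cases hc : ∀ x y, f x = f y
  · have hs : ∀ j, IsSymmetricAbout f j := fun j x => hc _ _
    rw [if_pos hc, if_pos ⟨0, hs 0⟩]
    simp [hs]
  · simp only [hc, if_false, mul_zero, sub_zero]
    by_cases he : ∃ j, IsSymmetricAbout f j
    · obtain ⟨j, hj⟩ := he
      rw [if_pos ⟨j, hj⟩, Finset.sum_eq_single j, if_pos hj]
      · intro i _ hij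
        rw [if_neg]
        intro hi
        exact hc (eq_of_isSymmetricAbout_of_ne hL h2 hi hj hij)
      · simp
    · rw [if_neg he]
      push Not at he
      simp [he]

open Classical in
theorem sum_prod_exists_isSymmetricAbout {B : Type*} [Fintype B] (w : B → ℝ) (hw : ∑ b, w b = 1)
    {L : ℕ} (hL : L.Prime) (h2 : 2 < L) [NeZero L] :
    ∑ f : ZMod L → B with ∃ j, IsSymmetricAbout f j, ∏ x, w (f x) =
      (L : ℝ) * (∑ b, w b ^ 2) ^ ((L - 1) / 2) - ((L : ℝ) - 1) * ∑ b, w b ^ L := by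
  have hodd := hL.odd_of_ne_two (by omega)
  have hsym : ∀ j : ZMod L, ∑ f : ZMod L → B with IsSymmetricAbout f j, ∏ x, w (f x) =
      (∑ b, w b ^ 2) ^ ((L - 1) / 2) := by
    obtain ⟨m, rfl⟩ := hodd
    intro j
    have := sum_prod_isSymmetricAbout w j
    rw [hw, one_mul] at this
    convert this using 2
    omega
  have hind : ∀ (P : (ZMod L → B) → Prop) [DecidablePred P], ∑ f : ZMod L → B with P f, ∏ x, w (f x) =
      ∑ f : ZMod L → B, (if P f then (1 : ℝ) else 0) * ∏ x, w (f x) := by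
    intro P _
    rw [Finset.sum_filter]
    exact Finset.sum_congr rfl fun f _ => by split_ifs <;> simp
  rw [hind]
  simp only [indicator_exists_isSymmetricAbout hL h2, sub_mul, Finset.sum_sub_distrib,
    Finset.sum_mul, mul_assoc, ← Finset.mul_sum]
  rw [Finset.sum_comm]
  simp only [← hind, hsym]
  rw [sum_prod_constant, ZMod.card]
  simp

/-! ### The law of the random potential and the two probabilities. -/

/-- The sign `1` or `-1` encoded by a Boolean. -/
def signOf (b : Bool) : ℤ := if b then 1 else -1

theorem signOf_injective : Function.Injective signOf := by
  decide

/-- The probability of the sign encoded by a Boolean. -/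
def signWeight (p : unitInterval) (b : Bool) : ℝ := if b then p else 1 - p

theorem bernoulliMeasure_real_signOf (p : unitInterval) (b : Bool) :
    (ProbabilityTheory.bernoulliMeasure (1 : ℝ) (-1) p).real {(signOf b : ℝ)} =
      signWeight p b := by
  have h : (-1 : ℝ) ≠ 1 := by norm_num
  cases b <;> simp [signOf, signWeight, h, h.symm]

theorem ae_bernoulliMeasure_mem_range (p : unitInterval) :
    ∀ᵐ x ∂(ProbabilityTheory.bernoulliMeasure (1 : ℝ) (-1) p), ∃ b, x = (signOf b : ℝ) := by
  have hset : {x : ℝ | ¬ ∃ b, x = (signOf b : ℝ)} = ({1, -1} : Set ℝ)ᶜ := by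
    ext x
    simp [signOf]
    tauto
  rw [ae_iff, hset, ProbabilityTheory.bernoulliMeasure_apply_of_notMem_of_notMem]
  · exact (Set.toFinite _).measurableSet.compl
  · simp
  · simp

instance {X : Type*} [Fintype X] (p : unitInterval) : IsProbabilityMeasure (potentialLaw X p) := by
  unfold potentialLaw
  infer_instance

theorem ae_potentialLaw {X : Type*} [Fintype X] (p : unitInterval) :
    ∀ᵐ v ∂(potentialLaw X p), ∃ f : X → Bool, v = fun x => (signOf (f x) : ℝ) := by
  have h : ∀ᵐ v ∂(potentialLaw X p), ∀ x, ∃ b, v x = (signOf b : ℝ) :=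
    Filter.eventually_all.2 fun x =>
      (Measure.tendsto_eval_ae_ae (i := x)
        (μ := fun _ : X => ProbabilityTheory.bernoulliMeasure (1 : ℝ) (-1) p)).eventually
        (ae_bernoulliMeasure_mem_range p)
  filter_upwards [h] with v hv
  choose f hf using hv
  exact ⟨f, funext hf⟩

theorem potentialLaw_real_singleton {X : Type*} [Fintype X] (p : unitInterval) (f : X → Bool) :
    (potentialLaw X p).real {fun x => (signOf (f x) : ℝ)} = ∏ x, signWeight p (f x) := by
  rw [← Set.univ_pi_singleton, potentialLaw, measureReal_def, Measure.pi_pi, ENNReal.toReal_prod]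
  exact Finset.prod_congr rfl fun x _ => bernoulliMeasure_real_signOf p (f x)

/-- The random potential has finite support, so that every event is a finite sum of weights. -/
theorem potentialLaw_real_eq_sum {X : Type*} [Fintype X] [DecidableEq X] (p : unitInterval)
    (S : Set (X → ℝ)) (P : (X → Bool) → Prop) [DecidablePred P]
    (hP : ∀ f, P f ↔ (fun x => (signOf (f x) : ℝ)) ∈ S) :
    (potentialLaw X p).real S = ∑ f : X → Bool with P f, ∏ x, signWeight p (f x) := by
  have hae : S =ᵐ[potentialLaw X p]
      (⋃ f ∈ Finset.univ.filter P, {fun x => (signOf (f x) : ℝ)} : Set (X → ℝ)) := by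
    filter_upwards [ae_potentialLaw p] with v hv
    obtain ⟨f, rfl⟩ := hv
    refine propext ⟨fun h => ?_, fun h => ?_⟩
    · exact Set.mem_biUnion (by simpa using (hP f).2 h) rfl
    · obtain ⟨g, hg, hgf⟩ := Set.mem_iUnion₂.1 h
      rw [Set.mem_singleton_iff.1 hgf]
      exact (hP g).1 (by simpa using hg)
  rw [measureReal_congr hae, measureReal_biUnion_finset]
  · exact Finset.sum_congr rfl fun f _ => potentialLaw_real_singleton p f
  · intro f _ g _ hfg
    refine Set.disjoint_singleton.2 fun h => hfg (funext fun x => signOf_injective ?_)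
    exact_mod_cast congrFun h x
  · exact fun f _ => measurableSet_singleton _

theorem isSymmetricAbout_comp_iff {α β : Type*} {L : ℕ} {f : ZMod L → α} {g : α → β}
    (hg : Function.Injective g) {j : ZMod L} :
    IsSymmetricAbout (fun x => g (f x)) j ↔ IsSymmetricAbout f j :=
  forall_congr' fun _ => hg.eq_iff

/-- For sign potentials on a cycle of odd prime length, being bad amounts to having a reflection
symmetry. -/
theorem isBad_signOf_iff {n : ℕ} (hL : (n + 3).Prime) (f : ZMod (n + 3) → Bool) :
    IsBad (SimpleGraph.cycleGraph (n + 3)) (fun x : Fin (n + 3) => (signOf (f x) : ℝ)) ↔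
      ∃ j, IsSymmetricAbout f j := by
  constructor
  · contrapose!
    intro h
    refine (isGood_of_forall_not_isSymmetricAbout hL (u := fun x => signOf (f x))
      fun j hj => h j ?_).not_isBad
    exact (isSymmetricAbout_comp_iff signOf_injective).1 hj
  · rintro ⟨j, hj⟩
    exact isBad_of_isSymmetricAbout (j := j) fun x =>
      congrArg (fun b => (signOf b : ℝ)) (hj x)

theorem isGood_signOf_iff {n : ℕ} (hL : (n + 3).Prime) (f : ZMod (n + 3) → Bool) :
    IsGood (SimpleGraph.cycleGraph (n + 3)) (fun x : Fin (n + 3) => (signOf (f x) : ℝ)) ↔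
      ¬ IsBad (SimpleGraph.cycleGraph (n + 3)) (fun x : Fin (n + 3) => (signOf (f x) : ℝ)) := by
  refine ⟨IsGood.not_isBad, fun h => ?_⟩
  rw [isBad_signOf_iff hL] at h
  push Not at h
  exact isGood_of_forall_not_isSymmetricAbout hL (u := fun x => signOf (f x)) fun j hj =>
    h j ((isSymmetricAbout_comp_iff signOf_injective).1 hj)

theorem potentialLaw_real_isBad (p : unitInterval) {L : ℕ} (hL : L.Prime) (h2 : 2 < L) :
    (potentialLaw (Fin L) p).real {v | IsBad (SimpleGraph.cycleGraph L) v} =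
      (L : ℝ) * ((p : ℝ) ^ 2 + (1 - (p : ℝ)) ^ 2) ^ ((L - 1) / 2) -
        ((L : ℝ) - 1) * ((p : ℝ) ^ L + (1 - (p : ℝ)) ^ L) := by
  classical
  obtain ⟨n, rfl⟩ : ∃ n, L = n + 3 := ⟨L - 3, by omega⟩
  have hsum := sum_prod_exists_isSymmetricAbout (signWeight p) (by simp [signWeight]) hL h2
  simp only [Fintype.sum_bool] at hsum
  refine (potentialLaw_real_eq_sum p _ (fun f => ∃ j, IsSymmetricAbout (L := n + 3) f j)
    fun f => (isBad_signOf_iff hL f).symm).trans ?_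
  convert hsum using 1
  simp [signWeight]

/-- Good and bad are complementary on sign potentials, and these carry the whole mass. -/
theorem potentialLaw_real_isGood (p : unitInterval) {L : ℕ} (hL : L.Prime) (h2 : 2 < L) :
    (potentialLaw (Fin L) p).real {v | IsGood (SimpleGraph.cycleGraph L) v} =
      1 - (potentialLaw (Fin L) p).real {v | IsBad (SimpleGraph.cycleGraph L) v} := by
  classical
  obtain ⟨n, rfl⟩ : ∃ n, L = n + 3 := ⟨L - 3, by omega⟩
  rw [potentialLaw_real_eq_sum p {v | IsGood (SimpleGraph.cycleGraph (n + 3)) v}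
      (fun f => ¬ IsBad (SimpleGraph.cycleGraph (n + 3)) fun x => (signOf (f x) : ℝ))
      (fun f => (isGood_signOf_iff hL f).symm),
    potentialLaw_real_eq_sum p {v | IsBad (SimpleGraph.cycleGraph (n + 3)) v}
      (fun f => IsBad (SimpleGraph.cycleGraph (n + 3)) fun x => (signOf (f x) : ℝ))
      (fun f => Iff.rfl), eq_sub_iff_add_eq, add_comm, Finset.sum_filter_add_sum_filter_not]
  have h1 := potentialLaw_real_eq_sum p (Set.univ : Set (Fin (n + 3) → ℝ)) (fun _ => True)
    (fun f => by simp)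
  rw [probReal_univ, Finset.filter_true] at h1
  exact h1.symm

/-! ### The limit of large `L`. -/

theorem tendsto_natCast_mul_pow_half {r : ℝ} (h0 : 0 ≤ r) (h1 : r < 1) :
    Filter.Tendsto (fun L : ℕ => (L : ℝ) * r ^ ((L - 1) / 2)) Filter.atTop (nhds 0) := by
  have hm : Filter.Tendsto (fun L : ℕ => (L - 1) / 2) Filter.atTop Filter.atTop :=
    Filter.tendsto_atTop_atTop.2 fun b => ⟨2 * b + 1, fun L hL => by omega⟩
  have hlim : Filter.Tendsto (fun m : ℕ => 2 * ((m : ℝ) * r ^ m) + 2 * r ^ m) Filter.atTop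
      (nhds 0) := by
    simpa using ((tendsto_self_mul_const_pow_of_lt_one h0 h1).const_mul 2).add
      ((tendsto_pow_atTop_nhds_zero_of_lt_one h0 h1).const_mul 2)
  refine squeeze_zero (fun L => by positivity) (fun L => ?_) (hlim.comp hm)
  have hL : (L : ℝ) ≤ 2 * ((L - 1) / 2 : ℕ) + 2 := by
    exact_mod_cast (by omega : L ≤ 2 * ((L - 1) / 2) + 2)
  calc (L : ℝ) * r ^ ((L - 1) / 2) ≤ (2 * ((L - 1) / 2 : ℕ) + 2) * r ^ ((L - 1) / 2) := by
        gcongr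
    _ = _ := by
        simp only [Function.comp_apply]
        ring

theorem tendsto_bad_probability {p : ℝ} (h0 : 0 < p) (h1 : p < 1) :
    Filter.Tendsto (fun L : ℕ => (L : ℝ) * (p ^ 2 + (1 - p) ^ 2) ^ ((L - 1) / 2) -
      ((L : ℝ) - 1) * (p ^ L + (1 - p) ^ L)) Filter.atTop (nhds 0) := by
  -- The left side is `1 - 2 p (1 - p)`.
  have hr : p ^ 2 + (1 - p) ^ 2 < 1 := by nlinarith
  have hq0 : 0 ≤ 1 - p := by linarith
  have hq1 : 1 - p < 1 := by linarith
  have hp := (tendsto_self_mul_const_pow_of_lt_one h0.le h1).sub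
    (tendsto_pow_atTop_nhds_zero_of_lt_one h0.le h1)
  have hq := (tendsto_self_mul_const_pow_of_lt_one hq0 hq1).sub
    (tendsto_pow_atTop_nhds_zero_of_lt_one hq0 hq1)
  have h := (tendsto_natCast_mul_pow_half (by positivity) hr).sub (hp.add hq)
  simp only [sub_zero, add_zero] at h
  refine h.congr fun L => ?_
  ring

end Anderson
end

/-- The one-dimensional periodic grid `ℤ/Lℤ` (side length `L > 2`) is the cycle graph on
`Fin L`; the limit `L → ∞` is taken along the primes. -/
theorem theorem1p4 (p : unitInterval) :
    (∀ L : ℕ, L.Prime → 2 < L →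
      (Anderson.potentialLaw (Fin L) p).real
          {v | Anderson.IsBad (SimpleGraph.cycleGraph L) v} =
        (L : ℝ) * ((p : ℝ) ^ 2 + (1 - (p : ℝ)) ^ 2) ^ ((L - 1) / 2) -
          ((L : ℝ) - 1) * ((p : ℝ) ^ L + (1 - (p : ℝ)) ^ L)) ∧
    (p ≠ 0 → p ≠ 1 →
      Filter.Tendsto
        (fun L : ℕ => (Anderson.potentialLaw (Fin L) p).real
          {v | Anderson.IsGood (SimpleGraph.cycleGraph L) v})
        (Filter.atTop ⊓ Filter.principal {L : ℕ | L.Prime}) (nhds 1)) := by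
  refine ⟨fun L hL h2 => Anderson.potentialLaw_real_isBad p hL h2, fun h0 h1 => ?_⟩
  have hlim := (Anderson.tendsto_bad_probability (unitInterval.pos_iff_ne_zero.2 h0)
    (unitInterval.lt_one_iff_ne_one.2 h1)).const_sub 1
  rw [sub_zero] at hlim
  -- The closed formula converges along all naturals; it equals the probability only at primes above
  -- 2, which suffices for the restricted filter.
  refine (hlim.mono_left inf_le_left).congr' ?_
  rw [Filter.EventuallyEq, Filter.eventually_inf_principal]
  filter_upwards [Filter.eventually_gt_atTop 2] with L h2 hL
  rw [Anderson.potentialLaw_real_isGood p hL h2, Anderson.potentialLaw_real_isBad p hL h2]
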